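/- Let \(\mathbb H\) be the real quaternions and \(\mathbb H[[z]]\) the ring of formal power series over \(\mathbb H\) in a variable \(z\) that commutes with the coefficients. For \(\alpha\in\mathbb H\), \(|\alpha|<1\), let \[ \mathbf b_\alpha(z)=(z-\alpha)(1-z\overline\alpha)^{-1}=(z-\alpha)\sum_{k\ge 0}\overline{\alpha}^{\,k}z^k . \] A Blaschke product of degree \(n\ge 0\) is a power series of the form \(\mathbf b_{\alpha_1}\cdots\mathbf b_{\alpha_n}\phi\) with \(|\alpha_i|<1\) and \(\phi\in\mathbb H\), \(|\phi|=1\); a finite Blaschke product is a Blaschke product of some degree. An element \(\mu\in\mathbb H\) is a right eigenvalue of \(A\in\mathbb H^{n\times n}\) if \(A\mathbf x=\mathbf x\mu\) for some nonzero \(\mathbf x\in\mathbb H^{n\times 1}\), and \(A\) is stable if all its right eigenvalues satisfy \(|\mu|<1\). (1) If \(\begin{bmatrix}A&B\\C&D\end{bmatrix}\in\mathbb H^{(n+1)\times(n+1)}\) with \(D\in\mathbb H\) is unitary and \(A\) is stable, then the power series \[ f(z)=D+zC(I-zA)^{-1}B=D+\sum_{k\ge 1}z^kCA^{k-1}B \]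 is a Blaschke product of degree \(n\), and it is not a Blaschke product of any other degree. (2) Conversely, every Blaschke product \(f\) of degree \(n\) is of the form \(f(z)=D+zC(I-zA)^{-1}B\) for some unitary matrix \(\begin{bmatrix}A&B\\C&D\end{bmatrix}\in\mathbb H^{(n+1)\times(n+1)}\) with \(A\in\mathbb H^{n\times n}\) stable. (3) Such a realization is built recursively from any factorization \(f=\mathbf b_{\alpha_1}\cdots\mathbf b_{\alpha_n}\phi\) with \(|\alpha_i|<1\), \(|\phi|=1\): let \(A_0,B_0,C_0\) be empty, \(D_0=1\), and for \(0\le k<n\), with \(s_{k+1}=\sqrt{1-|\alpha_{k+1}|^2}\), \[ A_{k+1}=\begin{bmatrix}A_k&s_{k+1}B_k\\0&\overline{\alpha}_{k+1}\end{bmatrix},\quad B_{k+1}=\begin{bmatrix}-B_k\alpha_{k+1}\\s_{k+1}\end{bmatrix},\quad C_{k+1}=\begin{bmatrix}C_k&s_{k+1}D_k\end{bmatrix},\quad D_{k+1}=-D_k\alpha_{k+1}. \] (Thus \(A_1=\overline{\alpha}_1\), \(B_1=C_1=\sqrt{1-|\alpha_1|^2}\), \(D_1=-\alpha_1\).) Then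 \(\begin{bmatrix}A_n&B_n\phi\\C_n&D_n\phi\end{bmatrix}\) is unitary, \(A_n\) is stable, and \(f(z)=D_n\phi+zC_n(I-zA_n)^{-1}B_n\phi\). -/

import Mathlib

open scoped Quaternion PowerSeries

namespace QBlaschke

/-! Power series over the quaternions: `ℍ⟦X⟧` is Mathlib's ring of formal power series, with the
convolution product; the variable `X` commutes with the coefficients. -/

/-- The power series `k_α(z) = ∑ ᾱ^k z^k`. -/
noncomputable def kernelSeries (α : ℍ) : ℍ⟦X⟧ :=
  PowerSeries.mk fun k => (star α) ^ k

/-- `k_α` is the formal inverse of the polynomial `1 - z ᾱ` (on the right). -/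
theorem one_sub_mul_kernelSeries (α : ℍ) :
    (1 - PowerSeries.X * PowerSeries.C (star α)) * kernelSeries α = 1 := by
  ext1 k
  rw [sub_mul, one_mul, mul_assoc]
  cases k with
  | zero => simp [kernelSeries]
  | succ k => simp [kernelSeries, PowerSeries.coeff_succ_X_mul, PowerSeries.coeff_one, pow_succ']

/-- `k_α` is the formal inverse of the polynomial `1 - z ᾱ` (on the left). -/
theorem kernelSeries_mul_one_sub (α : ℍ) :
    kernelSeries α * (1 - PowerSeries.X * PowerSeries.C (star α)) = 1 := by
  ext1 k
  rw [mul_sub, mul_one, ← mul_assoc, (PowerSeries.commute_X (kernelSeries α)).eq,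
    mul_assoc]
  cases k with
  | zero => simp [kernelSeries]
  | succ k => simp [kernelSeries, PowerSeries.coeff_succ_X_mul, PowerSeries.coeff_one, pow_succ]

/-- The Blaschke factor `b_α(z) = (z - α)(1 - z ᾱ)⁻¹`. -/
noncomputable def blaschkeFactor (α : ℍ) : ℍ⟦X⟧ :=
  (PowerSeries.X - PowerSeries.C α) * kernelSeries α

/-- The product `b_{α₁}(z) ⋯ b_{αₙ}(z) φ`, in this order. -/
noncomputable def blaschkeProduct {n : ℕ} (α : Fin n → ℍ) (φ : ℍ) : ℍ⟦X⟧ :=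
  (List.ofFn fun i => blaschkeFactor (α i)).prod * PowerSeries.C φ

/-- `f` is a product of `n` Blaschke factors with nodes in the open unit ball and of a unimodular
constant; for `n = 0`, `f` is a unimodular constant. -/
def IsBlaschkeProduct (n : ℕ) (f : ℍ⟦X⟧) : Prop :=
  ∃ (α : Fin n → ℍ) (φ : ℍ), (∀ i, ‖α i‖ < 1) ∧ ‖φ‖ = 1 ∧ f = blaschkeProduct α φ

/-- `μ` is a right eigenvalue of `A`: `A x = x μ` for some nonzero column `x`. -/
def IsRightEigenvalue {n : ℕ} (A : Matrix (Fin n) (Fin n) ℍ) (μ : ℍ) : Prop :=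
  ∃ x : Fin n → ℍ, x ≠ 0 ∧ A.mulVec x = fun i => x i * μ

/-- The right spectrum of a quaternionic matrix. -/
def rightSpectrum {n : ℕ} (A : Matrix (Fin n) (Fin n) ℍ) : Set ℍ :=
  {μ | IsRightEigenvalue A μ}

/-- `A` is stable: its right spectrum lies in the open unit ball. -/
def IsStable {n : ℕ} (A : Matrix (Fin n) (Fin n) ℍ) : Prop :=
  rightSpectrum A ⊆ Metric.ball (0 : ℍ) 1

/-- The four blocks of a quaternionic `(n+1) × (n+1)` matrix `[[A, B], [C, D]]`. -/
structure Blocks (n : ℕ) where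
  /-- the `n × n` block -/
  A : Matrix (Fin n) (Fin n) ℍ
  /-- the `n × 1` block -/
  B : Matrix (Fin n) (Fin 1) ℍ
  /-- the `1 × n` block -/
  C : Matrix (Fin 1) (Fin n) ℍ
  /-- the scalar block -/
  D : ℍ

/-- The matrix `[[A, B], [C, D]]`. -/
def Blocks.toMatrix {n : ℕ} (U : Blocks n) : Matrix (Fin n ⊕ Fin 1) (Fin n ⊕ Fin 1) ℍ :=
  Matrix.fromBlocks U.A U.B U.C !![U.D]

/-- `U U* = U* U = I`, where `U*` is the conjugate transpose. -/
def Blocks.IsUnitary {n : ℕ} (U : Blocks n) : Prop :=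
  U.toMatrix ∈ unitary (Matrix (Fin n ⊕ Fin 1) (Fin n ⊕ Fin 1) ℍ)

/-- The matrix `I - z A` with entries in `ℍ⟦X⟧`. -/
noncomputable def pencil {n : ℕ} (A : Matrix (Fin n) (Fin n) ℍ) :
    Matrix (Fin n) (Fin n) ℍ⟦X⟧ :=
  1 - (PowerSeries.X : ℍ⟦X⟧) • A.map PowerSeries.C

/-- The power series `f(z) = D + z C (I - z A)⁻¹ B`; the inverse is taken in the ring of matrices
over `ℍ⟦X⟧`, where `I - z A` is always invertible. -/
noncomputable def Blocks.transfer {n : ℕ} (U : Blocks n) : ℍ⟦X⟧ :=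
  PowerSeries.C U.D + PowerSeries.X *
    (U.C.map PowerSeries.C * Ring.inverse (pencil U.A) * U.B.map PowerSeries.C) 0 0

/-- The Neumann series `∑ z^k A^k`, as a matrix over `ℍ⟦X⟧`. -/
noncomputable def neumann {n : ℕ} (A : Matrix (Fin n) (Fin n) ℍ) :
    Matrix (Fin n) (Fin n) ℍ⟦X⟧ :=
  Matrix.of fun i j => PowerSeries.mk fun k => (A ^ k) i j

theorem pencil_mul_neumann {n : ℕ} (A : Matrix (Fin n) (Fin n) ℍ) :
    pencil A * neumann A = 1 := by
  ext1 i j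
  ext1 k
  rw [pencil, sub_mul, one_mul, smul_mul_assoc]
  cases k with
  | zero =>
    by_cases h : i = j <;> simp [neumann, Matrix.one_apply, h]
  | succ k =>
    have h1 : PowerSeries.coeff (k + 1) ((1 : Matrix (Fin n) (Fin n) ℍ⟦X⟧) i j) = 0 := by
      by_cases h : i = j <;> simp [Matrix.one_apply, h, PowerSeries.coeff_one]
    rw [h1]
    simp [neumann, Matrix.mul_apply, PowerSeries.coeff_succ_X_mul, pow_succ']

theorem neumann_mul_pencil {n : ℕ} (A : Matrix (Fin n) (Fin n) ℍ) :
    neumann A * pencil A = 1 := by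
  ext1 i j
  ext1 k
  have hX : neumann A * ((PowerSeries.X : ℍ⟦X⟧) • A.map PowerSeries.C) =
      (PowerSeries.X : ℍ⟦X⟧) • (neumann A * A.map PowerSeries.C) := by
    ext1 i j
    simp only [Matrix.mul_apply, Matrix.smul_apply, smul_eq_mul, Finset.mul_sum]
    refine Finset.sum_congr rfl fun l _ => ?_
    rw [← mul_assoc, (PowerSeries.commute_X (neumann A i l)).eq, mul_assoc]
  rw [pencil, mul_sub, mul_one, hX]
  cases k with
  | zero =>
    by_cases h : i = j <;> simp [neumann, Matrix.one_apply, h]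
  | succ k =>
    have h1 : PowerSeries.coeff (k + 1) ((1 : Matrix (Fin n) (Fin n) ℍ⟦X⟧) i j) = 0 := by
      by_cases h : i = j <;> simp [Matrix.one_apply, h, PowerSeries.coeff_one]
    rw [h1]
    simp [neumann, Matrix.mul_apply, PowerSeries.coeff_succ_X_mul, pow_succ]

theorem inverse_pencil {n : ℕ} (A : Matrix (Fin n) (Fin n) ℍ) :
    Ring.inverse (pencil A) = neumann A :=
  Ring.inverse_unit (⟨pencil A, neumann A, pencil_mul_neumann A, neumann_mul_pencil A⟩ :
    (Matrix (Fin n) (Fin n) ℍ⟦X⟧)ˣ)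

/-- The expansion `f(z) = D + ∑_{k ≥ 1} z^k C A^(k-1) B`. -/
theorem Blocks.transfer_eq {n : ℕ} (U : Blocks n) :
    U.transfer = PowerSeries.C U.D +
      PowerSeries.X * PowerSeries.mk fun k => (U.C * U.A ^ k * U.B) 0 0 := by
  rw [Blocks.transfer, inverse_pencil]
  congr 2
  ext1 k
  simp [neumann, Matrix.mul_apply]

/-- The recursive construction of the matrices `U_k = [[A_k, B_k], [C_k, D_k]]` from the nodes:
with `s = √(1 - |α_{k+1}|²)`,
`A_{k+1} = [[A_k, s B_k], [0, ᾱ_{k+1}]]`, `B_{k+1} = [[-B_k α_{k+1}], [s]]`,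
`C_{k+1} = [C_k, s D_k]`, `D_{k+1} = -D_k α_{k+1}`.
The recursion starts with empty `A_0`, `B_0`, `C_0` and `D_0 = 1`, so that `U_1` is
`[[ᾱ_1, √(1 - |α_1|²)], [√(1 - |α_1|²), -α_1]]`. -/
noncomputable def recursiveBlocks : (n : ℕ) → (Fin n → ℍ) → Blocks n
  | 0, _ => { A := 0, B := 0, C := 0, D := 1 }
  | k + 1, α =>
    let U := recursiveBlocks k (Fin.init α)
    let a : ℍ := α (Fin.last k)
    let s : ℍ := ((Real.sqrt (1 - ‖a‖ ^ 2) : ℝ) : ℍ)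
    { A := (Matrix.fromBlocks U.A (U.B * !![s]) 0 !![star a]).submatrix
        finSumFinEquiv.symm finSumFinEquiv.symm
      B := (Matrix.fromRows (-(U.B * !![a])) !![s]).submatrix finSumFinEquiv.symm id
      C := (Matrix.fromCols U.C !![U.D * s]).submatrix id finSumFinEquiv.symm
      D := -(U.D * a) }

/-- The first step of the recursion. -/
theorem recursiveBlocks_one (α : Fin 1 → ℍ) :
    recursiveBlocks 1 α =
      { A := !![star (α 0)]
        B := !![((Real.sqrt (1 - ‖α 0‖ ^ 2) : ℝ) : ℍ)]
        C := !![((Real.sqrt (1 - ‖α 0‖ ^ 2) : ℝ) : ℍ)]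
        D := -α 0 } := by
  have h : finSumFinEquiv.symm (0 : Fin (0 + 1)) = (Sum.inr 0 : Fin 0 ⊕ Fin 1) := by decide
  have h0 : ∀ i : Fin (0 + 1), i = 0 := by decide
  simp only [recursiveBlocks, Blocks.mk.injEq]
  refine ⟨?_, ?_, ?_, ?_⟩
  · ext1 i j
    rw [h0 i, h0 j, Matrix.submatrix_apply, h]
    simp
  · ext1 i j
    rw [h0 i, h0 j, Matrix.submatrix_apply, h]
    simp
  · ext1 i j
    rw [h0 i, h0 j, Matrix.submatrix_apply, h]
    simp
  · simp

/-- The matrix `[[A, B φ], [C, D φ]]`, the product of `[[A, B], [C, D]]` and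
`[[I, 0], [0, φ]]`. -/
noncomputable def Blocks.mulConst {n : ℕ} (U : Blocks n) (φ : ℍ) : Blocks n :=
  { A := U.A, B := U.B * !![φ], C := U.C, D := U.D * φ }

end QBlaschke

/-!
Multiplying a Blaschke product by one more factor on the right multiplies its unitary realization,
enlarged by one state, by an elementary unitary matrix that acts on the new state and the input
only. This is the recursive step, and it keeps the state matrix block triangular with the conjugate
of the new node on the diagonal. The power series `f` is computed from `U` without inverting
`I - z A`: it is the output for which `U` maps `(z x, 1)` to `(x, f)`, with `x` the states.

Conversely, a right eigenvector of `A*` may be moved by a unitary change of basis to the last basis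
vector, and scaled so that the input enters the last state with a real coefficient. Then the last
row of the unitary matrix is exactly that of the elementary factor, so the elementary factor splits
off and leaves a smaller stable unitary matrix. The constant `φ` is carried past a Blaschke factor
by conjugating its node.

The degree can be read off from `f f*`: a factor contributes the real rational function
`(z - α)(z - ᾱ) / ((1 - z α)(1 - z ᾱ))`, and in the product of these no cancellation is possible,
since the numerator has its roots inside the unit disc and the denominator outside.
-/

namespace QBlaschke

section Quaternion

theorem quaternion_star_mul_self (q : ℍ) : star q * q = ((‖q‖ ^ 2 : ℝ) : ℍ) := by
  rw [Quaternion.star_mul_self, Quaternion.normSq_eq_norm_mul_self, sq]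

theorem quaternion_self_mul_star (q : ℍ) : q * star q = ((‖q‖ ^ 2 : ℝ) : ℍ) := by
  rw [Quaternion.self_mul_star, Quaternion.normSq_eq_norm_mul_self, sq]

theorem mem_unitary_of_norm_eq_one {u : ℍ} (hu : ‖u‖ = 1) : u ∈ unitary ℍ := by
  simp [Unitary.mem_iff, quaternion_star_mul_self, quaternion_self_mul_star, hu]

theorem exists_star_mul_eq_coe_norm (q : ℍ) : ∃ u : ℍ, ‖u‖ = 1 ∧ star u * q = (‖q‖ : ℝ) := by
  rcases eq_or_ne q 0 with rfl | hq
  · exact ⟨1, by simp⟩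
  · have hq' : ‖q‖ ≠ 0 := norm_ne_zero_iff.mpr hq
    refine ⟨‖q‖⁻¹ • q, by simp [norm_smul, hq'], ?_⟩
    rw [Quaternion.star_smul, smul_mul_assoc, quaternion_star_mul_self, ← Quaternion.coe_smul,
      smul_eq_mul, sq, inv_mul_cancel_left₀ hq']

end Quaternion

section UnitaryMatrix

open Matrix

variable {R m n : Type*} [Ring R] [StarRing R] [Fintype m] [DecidableEq m] [Fintype n]
  [DecidableEq n]

theorem submatrix_mem_unitary {M : Matrix m m R} (hM : M ∈ unitary (Matrix m m R)) (e : n ≃ m) :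
    M.submatrix e e ∈ unitary (Matrix n n R) := by
  rw [Unitary.mem_iff, star_eq_conjTranspose] at hM ⊢
  rw [conjTranspose_submatrix, submatrix_mul_equiv, submatrix_mul_equiv, hM.1, hM.2,
    submatrix_one_equiv, and_self]

theorem fromBlocks_diagonal_mem_unitary {M : Matrix m m R} {N : Matrix n n R}
    (hM : M ∈ unitary (Matrix m m R)) (hN : N ∈ unitary (Matrix n n R)) :
    fromBlocks M 0 0 N ∈ unitary (Matrix (m ⊕ n) (m ⊕ n) R) := by
  rw [Unitary.mem_iff, star_eq_conjTranspose] at hM hN ⊢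
  simp [fromBlocks_conjTranspose, fromBlocks_multiply, hM, hN]

theorem exists_eq_fromBlocks_of_mem_unitary {W : Matrix (m ⊕ n) (m ⊕ n) R}
    (hW : W ∈ unitary (Matrix (m ⊕ n) (m ⊕ n) R)) (h₂₁ : W.toBlocks₂₁ = 0)
    (h₂₂ : W.toBlocks₂₂ = 1) :
    ∃ M ∈ unitary (Matrix m m R), W = fromBlocks M 0 0 1 := by
  obtain ⟨hl, hr⟩ := Unitary.mem_iff.mp hW
  rw [← fromBlocks_toBlocks W, h₂₁, h₂₂] at hl hr ⊢
  simp only [star_eq_conjTranspose, fromBlocks_conjTranspose, fromBlocks_multiply,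
    ← fromBlocks_one, fromBlocks_inj, conjTranspose_zero, conjTranspose_one, Matrix.mul_one,
    Matrix.mul_zero, zero_add, add_zero] at hl hr
  have h₁₂ : W.toBlocks₁₂ = 0 := hr.2.1
  refine ⟨W.toBlocks₁₁, Unitary.mem_iff.mpr ⟨hl.1, ?_⟩, by rw [h₁₂]⟩
  simpa [h₁₂, star_eq_conjTranspose] using hr.1

end UnitaryMatrix

section QuaternionMatrix

open Matrix

variable {m : Type*} [Fintype m]

theorem star_dotProduct_self (v : m → ℍ) : star v ⬝ᵥ v = ((∑ i, ‖v i‖ ^ 2 : ℝ) : ℍ) := by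
  rw [← Quaternion.algebraMap_def, map_sum]
  exact Finset.sum_congr rfl fun i _ => quaternion_star_mul_self (v i)

variable [DecidableEq m]

theorem sum_norm_sq_col_of_mem_unitary {M : Matrix m m ℍ} (hM : M ∈ unitary (Matrix m m ℍ))
    (j : m) : ∑ i, ‖M i j‖ ^ 2 = 1 := by
  have h : (star M * M) j j = star (M.col j) ⬝ᵥ M.col j := rfl
  rw [Unitary.star_mul_self_of_mem hM, one_apply_eq, star_dotProduct_self] at h
  exact Quaternion.coe_injective h.symm

theorem sum_norm_sq_row_of_mem_unitary {M : Matrix m m ℍ} (hM : M ∈ unitary (Matrix m m ℍ))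
    (i : m) : ∑ j, ‖M i j‖ ^ 2 = 1 := by
  simpa using sum_norm_sq_col_of_mem_unitary (Unitary.star_mem hM) i

/-- The Householder reflection in the hyperplane orthogonal to `v`. For `v = 0` the scalar is
`2 / 0 = 0`, so that the reflection is the identity. -/
noncomputable def householder (v : m → ℍ) : Matrix m m ℍ :=
  1 - (2 / ∑ i, ‖v i‖ ^ 2 : ℝ) • vecMulVec v (star v)

theorem star_householder (v : m → ℍ) : star (householder v) = householder v := by
  ext1 i j
  simp [householder, vecMulVec_apply, one_apply, eq_comm (a := i), apply_ite star]

theorem householder_mul_self (v : m → ℍ) : householder v * householder v = 1 := by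
  rw [householder]
  set N := ∑ i, ‖v i‖ ^ 2 with hN
  have hproj : vecMulVec v (star v) * vecMulVec v (star v) = N • vecMulVec v (star v) := by
    rw [vecMulVec_mul_vecMulVec, star_dotProduct_self, ← hN]
    ext1 i j
    simp [vecMulVec_apply, Quaternion.coe_mul_eq_smul]
  have hN' : 2 / N * (2 / N) * N = 2 / N + 2 / N := by
    rcases eq_or_ne N 0 with h | h
    · simp [h]
    · field_simp
      norm_num
  rw [mul_sub, mul_one, sub_mul, one_mul, smul_mul_smul_comm, hproj, smul_smul, hN',
    add_smul]
  abel

theorem householder_mem_unitary (v : m → ℍ) : householder v ∈ unitary (Matrix m m ℍ) := by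
  simp [Unitary.mem_iff, star_householder, householder_mul_self]

theorem householder_sub_mulVec {x y : m → ℍ} (hnorm : star x ⬝ᵥ x = star y ⬝ᵥ y)
    (hsymm : star x ⬝ᵥ y = star y ⬝ᵥ x) : householder (x - y) *ᵥ x = y := by
  rw [householder]
  set N := ∑ i, ‖(x - y) i‖ ^ 2 with hN
  have hinner : star (x - y) ⬝ᵥ x = ((N / 2 : ℝ) : ℍ) := by
    have h : (2 : ℝ) • (star (x - y) ⬝ᵥ x) = (N : ℍ) := by
      rw [hN, ← star_dotProduct_self, two_smul]
      simp only [star_sub, sub_dotProduct, dotProduct_sub, ← hnorm, hsymm]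
      abel
    rw [div_eq_inv_mul, ← smul_eq_mul, Quaternion.coe_smul, ← h, inv_smul_smul₀ two_ne_zero]
  rcases eq_or_ne N 0 with h | h
  · have hxy : x - y = 0 := funext fun i => by
      have hi := (Finset.sum_eq_zero_iff_of_nonneg fun i _ => sq_nonneg ‖(x - y) i‖).mp h i
      simpa using hi (Finset.mem_univ i)
    simp [h, sub_eq_zero.mp hxy]
  · rw [sub_mulVec, one_mulVec, smul_mulVec, vecMulVec_mulVec, hinner]
    ext1 i
    have hN' : 2 / N * (N / 2) = 1 := by field_simp
    simp only [Pi.sub_apply, Pi.smul_apply, MulOpposite.smul_eq_mul_unop, MulOpposite.unop_op,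
      Quaternion.mul_coe_eq_smul, smul_smul, hN', one_smul, sub_sub_cancel]

theorem exists_mem_unitary_mulVec_single_eq {x : m → ℍ} (hx : ∑ i, ‖x i‖ ^ 2 = 1) (i : m) :
    ∃ H ∈ unitary (Matrix m m ℍ), H *ᵥ Pi.single i 1 = x := by
  obtain ⟨u, hu, hux⟩ := exists_star_mul_eq_coe_norm (x i)
  have hu' := mem_unitary_of_norm_eq_one hu
  have hD : diagonal (fun _ : m => u) ∈ unitary (Matrix m m ℍ) := by
    simp [Unitary.mem_iff, star_eq_conjTranspose, diagonal_conjTranspose,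
      Unitary.star_mul_self_of_mem hu', Unitary.mul_star_self_of_mem hu']
  refine ⟨householder (Pi.single i u - x) * diagonal fun _ => u,
    mul_mem (householder_mem_unitary _) hD, ?_⟩
  rw [← mulVec_mulVec, diagonal_mulVec_single, mul_one]
  apply householder_sub_mulVec
  · rw [star_dotProduct_self x, hx]
    simp [Unitary.star_mul_self_of_mem hu']
  · have h : star (x i) * u = star u * x i := by
      rw [← star_star_mul, hux, Quaternion.star_coe]
    simp [h]

end QuaternionMatrix

section RightEigenvalue

open Matrix MulOpposite

variable {n : ℕ}

theorem exists_isRightEigenvalue (A : Matrix (Fin (n + 1)) (Fin (n + 1)) ℍ) :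
    ∃ μ, IsRightEigenvalue A μ := by
  -- Right multiplication by complex numbers makes `ℍⁿ⁺¹` a complex space on which `A` is linear.
  let _ : Module ℂ (Fin (n + 1) → ℍ) := Module.compHom _
    ((Quaternion.ofComplex : ℂ →+* ℍ).toOpposite fun x y => (Commute.all x y).map _)
  have smul_def (c : ℂ) (x : Fin (n + 1) → ℍ) : c • x = op (c : ℍ) • x := rfl
  have : IsScalarTower ℝ ℂ (Fin (n + 1) → ℍ) := ⟨fun r c x => by
    ext1 i
    simp only [smul_def, Pi.smul_apply, smul_eq_mul_unop, unop_op, ← mul_smul_comm]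
    congr 1
    exact map_smul Quaternion.ofComplex r c⟩
  have : FiniteDimensional ℂ (Fin (n + 1) → ℍ) :=
    Module.Finite.of_restrictScalars_finite ℝ ℂ _
  let f : Module.End ℂ (Fin (n + 1) → ℍ) :=
    { toFun := A.mulVec
      map_add' := A.mulVec_add
      map_smul' := fun c x => A.mulVec_smul (op (c : ℍ)) x }
  obtain ⟨c, hc⟩ := Module.End.exists_eigenvalue f
  obtain ⟨x, hx⟩ := hc.exists_hasEigenvector
  exact ⟨c, x, hx.2, hx.apply_eq_smul⟩

theorem exists_unit_right_eigenvector (A : Matrix (Fin (n + 1)) (Fin (n + 1)) ℍ)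
    (b : Fin (n + 1) → ℍ) :
    ∃ (x : Fin (n + 1) → ℍ) (μ : ℍ) (s : ℝ),
      ∑ i, ‖x i‖ ^ 2 = 1 ∧ A *ᵥ x = op μ • x ∧ 0 ≤ s ∧ star x ⬝ᵥ b = s := by
  obtain ⟨μ, x, hx, hAx⟩ := exists_isRightEigenvalue A
  obtain ⟨u, hu, hub⟩ := exists_star_mul_eq_coe_norm (star x ⬝ᵥ b)
  have hN : 0 < ∑ i, ‖x i‖ ^ 2 := by
    obtain ⟨i, hi⟩ := Function.ne_iff.mp hx
    exact Finset.sum_pos' (fun i _ => by positivity)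
      ⟨i, Finset.mem_univ i, by have := norm_pos_iff.mpr hi; positivity⟩
  set c : ℝ := (√(∑ i, ‖x i‖ ^ 2))⁻¹ with hc
  have hc₀ : 0 < c := by positivity
  set q : ℍ := c • u with hq
  have hq₀ : q ≠ 0 := smul_ne_zero hc₀.ne' (norm_ne_zero_iff.mp (by simp [hu]))
  refine ⟨op q • x, q⁻¹ * μ * q, c * ‖star x ⬝ᵥ b‖, ?_, ?_, by positivity, ?_⟩
  · have hq_norm : ‖q‖ ^ 2 * ∑ i, ‖x i‖ ^ 2 = 1 := by
      rw [hq, norm_smul, hu, mul_one, Real.norm_of_nonneg hc₀.le, hc, inv_pow, Real.sq_sqrt hN.le,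
        inv_mul_cancel₀ hN.ne']
    simpa [mul_pow, Finset.sum_mul, mul_comm] using hq_norm
  · have hAx' : A *ᵥ x = op μ • x := hAx
    rw [mulVec_smul, hAx', smul_smul, smul_smul, ← op_mul, ← op_mul, mul_assoc,
      mul_inv_cancel_left₀ hq₀]
  · have hstar : star (op q • x) = star q • star x := funext fun i => star_mul (x i) q
    rw [hstar, smul_dotProduct, hq, Quaternion.star_smul, smul_assoc, smul_eq_mul (star u), hub,
      ← Quaternion.coe_smul, smul_eq_mul]

theorem IsStable.of_mul_eq_mul {k : ℕ} {A : Matrix (Fin n) (Fin n) ℍ}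
    {A' : Matrix (Fin k) (Fin k) ℍ} {P : Matrix (Fin n) (Fin k) ℍ} (hA : IsStable A)
    (hP : Function.Injective P.mulVec) (h : A * P = P * A') : IsStable A' := by
  rintro μ ⟨x, hx, hμ⟩
  refine hA ⟨P *ᵥ x, fun h₀ => hx (hP (h₀.trans P.mulVec_zero.symm)), ?_⟩
  rw [mulVec_mulVec, h, ← mulVec_mulVec, hμ]
  exact P.mulVec_smul (op μ) x

theorem IsStable.submatrix_castSucc {A : Matrix (Fin (n + 1)) (Fin (n + 1)) ℍ} (hA : IsStable A)
    (h : ∀ j : Fin n, A (Fin.last n) j.castSucc = 0) :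
    IsStable (A.submatrix Fin.castSucc Fin.castSucc) := by
  rintro μ ⟨x, hx, hμ⟩
  refine hA ⟨Fin.snoc x 0, fun h₀ => hx ?_, funext <| Fin.lastCases ?_ fun i => ?_⟩
  · ext1 i
    simpa using congrFun h₀ i.castSucc
  · simp [mulVec, dotProduct, Fin.sum_univ_castSucc, h]
  · simpa [mulVec, dotProduct, Fin.sum_univ_castSucc] using congrFun hμ i

theorem isStable_of_submatrix_castSucc {A : Matrix (Fin (n + 1)) (Fin (n + 1)) ℍ}
    (hA : IsStable (A.submatrix Fin.castSucc Fin.castSucc))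
    (h : ∀ j : Fin n, A (Fin.last n) j.castSucc = 0) (hlast : ‖A (Fin.last n) (Fin.last n)‖ < 1) :
    IsStable A := by
  rintro μ ⟨x, hx, hμ⟩
  by_cases hx₀ : x (Fin.last n) = 0
  · refine hA ⟨Fin.init x, fun h₀ => hx ?_, ?_⟩
    · exact funext <| Fin.lastCases hx₀ (congrFun h₀)
    · ext1 i
      simpa [mulVec, dotProduct, Fin.sum_univ_castSucc, hx₀, Fin.init] using congrFun hμ i.castSucc
  · have hnorm : ‖A (Fin.last n) (Fin.last n)‖ = ‖μ‖ := by
      have := congrArg norm (congrFun hμ (Fin.last n))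
      simpa [mulVec, dotProduct, Fin.sum_univ_castSucc, h, mul_comm, hx₀] using this
    simpa [← hnorm] using hlast

theorem IsStable.norm_diag_lt_one {A : Matrix (Fin n) (Fin n) ℍ} (hA : IsStable A) {j : Fin n}
    (hj : ∑ i, ‖A i j‖ ^ 2 ≤ 1) : ‖A j j‖ < 1 := by
  by_contra! hjj
  have hoff (i : Fin n) (hij : i ≠ j) : A i j = 0 := by
    have : ‖A i j‖ ^ 2 + ‖A j j‖ ^ 2 ≤ 1 := by
      rw [← Finset.sum_pair (f := fun i => ‖A i j‖ ^ 2) hij]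
      exact (Finset.sum_le_univ_sum_of_nonneg fun _ => by positivity).trans hj
    have : ‖A i j‖ ^ 2 ≤ 0 := by nlinarith
    simpa using this.antisymm (by positivity)
  have heig : IsRightEigenvalue A (A j j) := by
    refine ⟨Pi.single j 1, by simp, ?_⟩
    ext1 i
    rcases eq_or_ne i j with rfl | hij
    · simp
    · simp [hij, hoff]
  exact (mem_ball_zero_iff.mp (hA heig)).not_ge hjj

end RightEigenvalue

section Response

open Matrix MulOpposite

theorem mulVec_X_smul {R m n : Type*} [Semiring R] [Fintype n] (M : Matrix m n R⟦X⟧)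
    (x : n → R⟦X⟧) :
    M *ᵥ ((PowerSeries.X : R⟦X⟧) • x) = (PowerSeries.X : R⟦X⟧) • (M *ᵥ x) := by
  have hX : (PowerSeries.X : R⟦X⟧) • x = op (PowerSeries.X : R⟦X⟧) • x :=
    funext fun i => (PowerSeries.commute_X (x i)).symm
  rw [hX, mulVec_smul]
  exact funext fun i => PowerSeries.commute_X ((M *ᵥ x) i)

variable {n : ℕ}

/-- `U` answers the input `1` with the output `f` when its states are `x`, that is,
`x = z A x + B` and `f = z C x + D`. -/
def Blocks.IsResponse (U : Blocks n) (x : Fin n → ℍ⟦X⟧) (f : ℍ⟦X⟧) : Prop :=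
  U.toMatrix.map PowerSeries.C *ᵥ Sum.elim ((PowerSeries.X : ℍ⟦X⟧) • x) 1 = Sum.elim x fun _ => f

theorem Blocks.isResponse_iff {U : Blocks n} {x : Fin n → ℍ⟦X⟧} {f : ℍ⟦X⟧} :
    U.IsResponse x f ↔ pencil U.A *ᵥ x = U.B.map PowerSeries.C *ᵥ 1 ∧
      f = PowerSeries.C U.D + PowerSeries.X * (U.C.map PowerSeries.C *ᵥ x) 0 := by
  have hD : (!![U.D].map PowerSeries.C : Matrix (Fin 1) (Fin 1) ℍ⟦X⟧) *ᵥ 1 =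
      fun _ => PowerSeries.C U.D := by
    ext1 i
    simp [mulVec, dotProduct]
  rw [IsResponse, toMatrix, fromBlocks_map, fromBlocks_mulVec, Sum.elim_comp_inl,
    Sum.elim_comp_inr, Sum.elim_eq_iff, mulVec_X_smul, mulVec_X_smul, hD, pencil, sub_mulVec,
    one_mulVec, smul_mulVec, sub_eq_iff_eq_add', eq_comm (a := x)]
  refine and_congr_right fun _ => ?_
  simp [funext_iff, Fin.forall_fin_one, eq_comm, add_comm]

theorem Blocks.IsResponse.eq_transfer {U : Blocks n} {x : Fin n → ℍ⟦X⟧} {f : ℍ⟦X⟧}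
    (h : U.IsResponse x f) : f = U.transfer := by
  obtain ⟨hx, hf⟩ := isResponse_iff.mp h
  have hx' : x = neumann U.A *ᵥ (U.B.map PowerSeries.C *ᵥ 1) := by
    rw [← hx, mulVec_mulVec, neumann_mul_pencil, one_mulVec]
  rw [hf, hx', transfer, inverse_pencil, mulVec_mulVec, mulVec_mulVec, Matrix.mul_assoc]
  simp [mulVec, dotProduct]

theorem Blocks.exists_isResponse (U : Blocks n) :
    ∃ x : Fin n → ℍ⟦X⟧, U.IsResponse x U.transfer := by
  have h : pencil U.A *ᵥ (neumann U.A *ᵥ (U.B.map PowerSeries.C *ᵥ 1)) =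
      U.B.map PowerSeries.C *ᵥ 1 := by
    rw [mulVec_mulVec, pencil_mul_neumann, one_mulVec]
  have hU := isResponse_iff.mpr ⟨h, rfl⟩
  exact ⟨_, hU.eq_transfer ▸ hU⟩

theorem Blocks.IsResponse.mul_right {U : Blocks n} {x : Fin n → ℍ⟦X⟧} {f : ℍ⟦X⟧}
    (h : U.IsResponse x f) (g : ℍ⟦X⟧) :
    U.toMatrix.map PowerSeries.C *ᵥ Sum.elim ((PowerSeries.X : ℍ⟦X⟧) • op g • x) (fun _ => g) =
      Sum.elim (op g • x) fun _ => f * g := by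
  have hin : Sum.elim ((PowerSeries.X : ℍ⟦X⟧) • op g • x) (fun _ : Fin 1 => g) =
      op g • Sum.elim ((PowerSeries.X : ℍ⟦X⟧) • x) 1 := by
    ext1 (i | i) <;> simp [mul_assoc]
  rw [hin, mulVec_smul, h]
  ext1 (i | i) <;> rfl

end Response

section MulConst

open Matrix MulOpposite

variable {n : ℕ}

theorem Blocks.toMatrix_mulConst (U : Blocks n) (φ : ℍ) :
    (U.mulConst φ).toMatrix = U.toMatrix * fromBlocks 1 0 0 !![φ] := by
  simp [toMatrix, mulConst, fromBlocks_multiply]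

theorem Blocks.IsUnitary.mulConst {U : Blocks n} (hU : U.IsUnitary) {φ : ℍ} (hφ : ‖φ‖ = 1) :
    (U.mulConst φ).IsUnitary := by
  have hφ' : (!![φ] : Matrix (Fin 1) (Fin 1) ℍ) ∈ unitary (Matrix (Fin 1) (Fin 1) ℍ) := by
    obtain ⟨hl, hr⟩ := Unitary.mem_iff.mp (mem_unitary_of_norm_eq_one hφ)
    rw [Unitary.mem_iff]
    constructor <;> ext1 i j <;> obtain rfl := Subsingleton.elim i 0 <;>
      obtain rfl := Subsingleton.elim j 0 <;> simp [mul_apply, hl, hr]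
  rw [IsUnitary, toMatrix_mulConst]
  exact mul_mem hU (fromBlocks_diagonal_mem_unitary (one_mem _) hφ')

theorem Blocks.transfer_mulConst (U : Blocks n) (φ : ℍ) :
    (U.mulConst φ).transfer = U.transfer * PowerSeries.C φ := by
  obtain ⟨x, hx⟩ := U.exists_isResponse
  refine (IsResponse.eq_transfer (x := op (PowerSeries.C φ) • x) ?_).symm
  rw [IsResponse, toMatrix_mulConst, Matrix.map_mul, ← mulVec_mulVec, fromBlocks_map,
    fromBlocks_mulVec, ← hx.mul_right]
  congr 2
  · simp
  · ext1 i
    simp [mulVec, dotProduct]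

end MulConst

section Conj

open Matrix

variable {n : ℕ}

/-- The change of the orthonormal basis of the state space given by the columns of `H`: the blocks
`[[H* A H, H* B], [C H, D]]`. -/
noncomputable def Blocks.conj (U : Blocks n) (H : Matrix (Fin n) (Fin n) ℍ) : Blocks n where
  A := Hᴴ * U.A * H
  B := Hᴴ * U.B
  C := U.C * H
  D := U.D

theorem Blocks.toMatrix_conj (U : Blocks n) (H : Matrix (Fin n) (Fin n) ℍ) :
    (U.conj H).toMatrix = fromBlocks Hᴴ 0 0 1 * (U.toMatrix * fromBlocks H 0 0 1) := by
  simp [toMatrix, conj, fromBlocks_multiply, Matrix.mul_assoc]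

variable {U : Blocks n} {H : Matrix (Fin n) (Fin n) ℍ}

theorem Blocks.IsUnitary.conj (hU : U.IsUnitary) (hH : H ∈ unitary (Matrix (Fin n) (Fin n) ℍ)) :
    (U.conj H).IsUnitary := by
  rw [IsUnitary, toMatrix_conj]
  exact mul_mem (fromBlocks_diagonal_mem_unitary (Unitary.star_mem hH) (one_mem _))
    (mul_mem hU (fromBlocks_diagonal_mem_unitary hH (one_mem _)))

theorem IsStable.conj (hU : IsStable U.A) (hH : H ∈ unitary (Matrix (Fin n) (Fin n) ℍ)) :
    IsStable (U.conj H).A := by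
  obtain ⟨hl, hr⟩ := Unitary.mem_iff.mp hH
  refine hU.of_mul_eq_mul (P := H) (fun x y hxy => ?_) ?_
  · simpa [mulVec_mulVec, ← star_eq_conjTranspose, hl] using congrArg (Hᴴ *ᵥ ·) hxy
  · rw [Blocks.conj, ← star_eq_conjTranspose, mul_assoc (star H), ← mul_assoc H, hr, one_mul]

theorem Blocks.transfer_conj (U : Blocks n) (hH : H ∈ unitary (Matrix (Fin n) (Fin n) ℍ)) :
    (U.conj H).transfer = U.transfer := by
  have hmap : H.map PowerSeries.C * Hᴴ.map PowerSeries.C = 1 := by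
    rw [← Matrix.map_mul, ← star_eq_conjTranspose, Unitary.mul_star_self_of_mem hH,
      Matrix.map_one _ (map_zero _) (map_one _)]
  obtain ⟨x, hx⟩ := U.exists_isResponse
  refine (IsResponse.eq_transfer (x := Hᴴ.map PowerSeries.C *ᵥ x) ?_).symm
  have hin : (fromBlocks H 0 0 (1 : Matrix (Fin 1) (Fin 1) ℍ)).map PowerSeries.C *ᵥ
      Sum.elim ((PowerSeries.X : ℍ⟦X⟧) • (Hᴴ.map PowerSeries.C *ᵥ x)) 1 =
      Sum.elim ((PowerSeries.X : ℍ⟦X⟧) • x) 1 := by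
    rw [fromBlocks_map, fromBlocks_mulVec]
    simp [mulVec_X_smul, mulVec_mulVec, hmap]
  rw [IsResponse, toMatrix_conj, Matrix.map_mul, Matrix.map_mul, ← mulVec_mulVec, ← mulVec_mulVec,
    hin, hx, fromBlocks_map, fromBlocks_mulVec]
  simp

end Conj

section Defect

/-- The defect `√(1 - ‖a‖²)` of a point of the closed unit ball, the number `s` of the recursive
construction. -/
noncomputable def defect (a : ℍ) : ℝ :=
  √(1 - ‖a‖ ^ 2)

theorem norm_sq_add_defect_sq {a : ℍ} (ha : ‖a‖ ≤ 1) : ‖a‖ ^ 2 + defect a ^ 2 = 1 := by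
  rw [defect, Real.sq_sqrt (sub_nonneg.mpr (pow_le_one₀ (norm_nonneg a) ha)), add_sub_cancel]

theorem eq_defect {a : ℍ} {s : ℝ} (hs : 0 ≤ s) (h : ‖a‖ ^ 2 + s ^ 2 = 1) : s = defect a := by
  rw [defect, ← h, add_sub_cancel_left, Real.sqrt_sq hs]

theorem kernelSeries_eq_one_add (a : ℍ) :
    kernelSeries a = 1 + PowerSeries.X * (PowerSeries.C (star a) * kernelSeries a) := by
  rw [← sub_eq_iff_eq_add, ← one_sub_mul_kernelSeries a]
  noncomm_ring

theorem blaschkeFactor_eq_defect {a : ℍ} (ha : ‖a‖ ≤ 1) :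
    blaschkeFactor a = -PowerSeries.C a +
      PowerSeries.C (defect a : ℍ) *
        (PowerSeries.X * (PowerSeries.C (defect a : ℍ) * kernelSeries a)) := by
  set s := PowerSeries.C (defect a : ℍ)
  have hs : s * s = 1 - PowerSeries.C a * PowerSeries.C (star a) := by
    rw [← map_mul, ← map_mul, quaternion_self_mul_star, ← map_one PowerSeries.C, ← map_sub,
      ← Quaternion.coe_mul, ← Quaternion.coe_one, ← Quaternion.coe_sub,
      ← norm_sq_add_defect_sq ha, add_sub_cancel_left, sq]
  have hk : PowerSeries.C a * kernelSeries a = PowerSeries.C a +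
      PowerSeries.X * (PowerSeries.C a * (PowerSeries.C (star a) * kernelSeries a)) := by
    conv_lhs => rw [kernelSeries_eq_one_add, mul_add, mul_one, (PowerSeries.commute_X _).left_comm]
  rw [blaschkeFactor, sub_mul, hk, (PowerSeries.commute_X s).left_comm, ← mul_assoc s, hs]
  noncomm_ring

end Defect

section Step

open Matrix MulOpposite

variable {n : ℕ}

/-- One step of the recursive construction, with the new node `a`. -/
noncomputable def Blocks.step (U : Blocks n) (a : ℍ) : Blocks (n + 1) where
  A := (fromBlocks U.A (U.B * !![(defect a : ℍ)]) 0 !![star a]).submatrix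
    finSumFinEquiv.symm finSumFinEquiv.symm
  B := (fromRows (-(U.B * !![a])) !![(defect a : ℍ)]).submatrix finSumFinEquiv.symm id
  C := (fromCols U.C !![U.D * (defect a : ℍ)]).submatrix id finSumFinEquiv.symm
  D := -(U.D * a)

theorem recursiveBlocks_succ (α : Fin (n + 1) → ℍ) :
    recursiveBlocks (n + 1) α = (recursiveBlocks n (Fin.init α)).step (α (Fin.last n)) :=
  rfl

/-- The matrix `[[-a, s], [s, ā]]` with `s = defect a`, the unitary dilation of `-a`. -/
noncomputable def julia (a : ℍ) : Matrix (Fin 1 ⊕ Fin 1) (Fin 1 ⊕ Fin 1) ℍ :=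
  fromBlocks !![-a] !![(defect a : ℍ)] !![(defect a : ℍ)] !![star a]

theorem julia_mem_unitary {a : ℍ} (ha : ‖a‖ ≤ 1) :
    julia a ∈ unitary (Matrix (Fin 1 ⊕ Fin 1) (Fin 1 ⊕ Fin 1) ℍ) := by
  have hs : (‖a‖ : ℍ) ^ 2 + (defect a : ℍ) ^ 2 = 1 := by
    rw [← Quaternion.coe_pow, ← Quaternion.coe_pow, ← Quaternion.coe_add,
      norm_sq_add_defect_sq ha, Quaternion.coe_one]
  have habs : |defect a| = defect a := abs_of_nonneg (Real.sqrt_nonneg _)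
  rw [Unitary.mem_iff, star_eq_conjTranspose]
  constructor <;> ext1 (i | i) (j | j) <;> obtain rfl := Subsingleton.elim i 0 <;>
    obtain rfl := Subsingleton.elim j 0 <;>
    simp [julia, mul_apply, quaternion_star_mul_self, quaternion_self_mul_star,
      Quaternion.coe_commutes, habs, hs, add_comm]

theorem julia_mulVec {a : ℍ} (ha : ‖a‖ ≤ 1) :
    (julia a).map PowerSeries.C *ᵥ
        Sum.elim 1 (fun _ => PowerSeries.X * (PowerSeries.C (defect a : ℍ) * kernelSeries a)) =
      Sum.elim (fun _ => blaschkeFactor a)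
        (fun _ => PowerSeries.C (defect a : ℍ) * kernelSeries a) := by
  have hs : Commute (star a) (defect a : ℍ) := (Quaternion.coe_commutes _ _).symm
  rw [julia, fromBlocks_map, fromBlocks_mulVec]
  refine Sum.elim_eq_iff.mpr ⟨funext fun i => ?_, funext fun i => ?_⟩
  · simp [mulVec, dotProduct, blaschkeFactor_eq_defect ha]
  · conv_rhs => rw [kernelSeries_eq_one_add, mul_add, mul_one, (PowerSeries.commute_X _).left_comm,
      ← (hs.map PowerSeries.C).left_comm, ← (PowerSeries.commute_X _).left_comm]
    simp [mulVec, dotProduct]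

/-- `julia a`, acting on the last two of `n + 2` coordinates. -/
noncomputable def elementary (n : ℕ) (a : ℍ) :
    Matrix ((Fin n ⊕ Fin 1) ⊕ Fin 1) ((Fin n ⊕ Fin 1) ⊕ Fin 1) ℍ :=
  (fromBlocks 1 0 0 (julia a)).submatrix (Equiv.sumAssoc _ _ _) (Equiv.sumAssoc _ _ _)

theorem elementary_mem_unitary (n : ℕ) {a : ℍ} (ha : ‖a‖ ≤ 1) :
    elementary n a ∈
      unitary (Matrix ((Fin n ⊕ Fin 1) ⊕ Fin 1) ((Fin n ⊕ Fin 1) ⊕ Fin 1) ℍ) :=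
  submatrix_mem_unitary (fromBlocks_diagonal_mem_unitary (one_mem _) (julia_mem_unitary ha)) _

/-- The identification of indices which moves the last state behind the input (or output). -/
def stateEquiv (n : ℕ) : Fin (n + 1) ⊕ Fin 1 ≃ (Fin n ⊕ Fin 1) ⊕ Fin 1 :=
  (finSumFinEquiv.symm.sumCongr (Equiv.refl _)).trans
    ((Equiv.sumAssoc _ _ _).trans (((Equiv.refl _).sumCongr (Equiv.sumComm _ _)).trans
      (Equiv.sumAssoc _ _ _).symm))

@[simp]
theorem stateEquiv_inl_castSucc (i : Fin n) :
    stateEquiv n (Sum.inl i.castSucc) = Sum.inl (Sum.inl i) := by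
  simp [stateEquiv]

@[simp]
theorem stateEquiv_inl_last : stateEquiv n (Sum.inl (Fin.last n)) = Sum.inr 0 := by
  simp [stateEquiv]

@[simp]
theorem stateEquiv_inr (i : Fin 1) : stateEquiv n (Sum.inr i) = Sum.inl (Sum.inr i) := by
  simp [stateEquiv]

@[simp]
theorem stateEquiv_symm_inl_inl (i : Fin n) :
    (stateEquiv n).symm (Sum.inl (Sum.inl i)) = Sum.inl i.castSucc := by
  rw [Equiv.symm_apply_eq, stateEquiv_inl_castSucc]

@[simp]
theorem stateEquiv_symm_inl_inr (i : Fin 1) :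
    (stateEquiv n).symm (Sum.inl (Sum.inr i)) = Sum.inr i := by
  rw [Equiv.symm_apply_eq, stateEquiv_inr]

@[simp]
theorem stateEquiv_symm_inr : (stateEquiv n).symm (Sum.inr 0) = Sum.inl (Fin.last n) := by
  rw [Equiv.symm_apply_eq, stateEquiv_inl_last]

theorem sumElim_snoc {β : Type*} (x : Fin n → β) (t : β) (y : Fin 1 → β) :
    Sum.elim (Fin.snoc x t : Fin (n + 1) → β) y =
      Sum.elim (Sum.elim x y) (fun _ => t) ∘ stateEquiv n := by
  ext1 (i | i)
  · refine Fin.lastCases ?_ (fun i => ?_) i <;> simp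
  · simp

theorem Blocks.toMatrix_step (U : Blocks n) (a : ℍ) :
    (U.step a).toMatrix =
      (fromBlocks U.toMatrix 0 0 1 * elementary n a).submatrix (stateEquiv n) (stateEquiv n) := by
  ext1 (i | i) (j | j)
  · refine Fin.lastCases ?_ (fun i => ?_) i <;> refine Fin.lastCases ?_ (fun j => ?_) j <;>
      simp [step, elementary, julia, toMatrix, mul_apply, one_apply]
  · refine Fin.lastCases ?_ (fun i => ?_) i <;>
      simp [step, elementary, julia, toMatrix, mul_apply, one_apply, Subsingleton.elim j 0]
  · refine Fin.lastCases ?_ (fun j => ?_) j <;>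
      simp [step, elementary, julia, toMatrix, mul_apply, one_apply, Subsingleton.elim i 0]
  · simp [step, elementary, julia, toMatrix, mul_apply, Subsingleton.elim i 0,
      Subsingleton.elim j 0]

theorem Blocks.IsUnitary.step {U : Blocks n} (hU : U.IsUnitary) {a : ℍ} (ha : ‖a‖ ≤ 1) :
    (U.step a).IsUnitary := by
  rw [IsUnitary, toMatrix_step]
  exact submatrix_mem_unitary (mul_mem (fromBlocks_diagonal_mem_unitary hU (one_mem _))
    (elementary_mem_unitary n ha)) _

theorem IsStable.step {U : Blocks n} (hU : IsStable U.A) {a : ℍ} (ha : ‖a‖ < 1) :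
    IsStable (U.step a).A := by
  refine isStable_of_submatrix_castSucc ?_ (fun j => ?_) ?_
  · convert hU using 1
    ext1 i j
    simp [Blocks.step]
  · simp [Blocks.step]
  · simpa [Blocks.step] using ha

theorem elementary_mulVec {a : ℍ} (ha : ‖a‖ ≤ 1) (x : Fin n → ℍ⟦X⟧) :
    (elementary n a).map PowerSeries.C *ᵥ Sum.elim (Sum.elim x 1)
        (fun _ => PowerSeries.X * (PowerSeries.C (defect a : ℍ) * kernelSeries a)) =
      Sum.elim (Sum.elim x fun _ => blaschkeFactor a)
        (fun _ => PowerSeries.C (defect a : ℍ) * kernelSeries a) := by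
  have hassoc {β : Type _} (x : Fin n → β) (y z : Fin 1 → β) :
      Sum.elim (Sum.elim x y) z = Sum.elim x (Sum.elim y z) ∘ Equiv.sumAssoc _ _ _ := by
    ext1 ((i | i) | i) <;> rfl
  rw [elementary, ← submatrix_map, hassoc, hassoc, submatrix_mulVec_equiv, Function.comp_assoc,
    Equiv.self_comp_symm, Function.comp_id, fromBlocks_map, fromBlocks_mulVec]
  simp [julia_mulVec ha]

theorem Blocks.transfer_step (U : Blocks n) {a : ℍ} (ha : ‖a‖ ≤ 1) :
    (U.step a).transfer = U.transfer * blaschkeFactor a := by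
  obtain ⟨x, hx⟩ := U.exists_isResponse
  set ξ := PowerSeries.C (defect a : ℍ) * kernelSeries a
  refine (IsResponse.eq_transfer (x := Fin.snoc (op (blaschkeFactor a) • x) ξ) ?_).symm
  have hX : (PowerSeries.X : ℍ⟦X⟧) • (Fin.snoc (op (blaschkeFactor a) • x) ξ : Fin (n + 1) → ℍ⟦X⟧) =
      Fin.snoc ((PowerSeries.X : ℍ⟦X⟧) • op (blaschkeFactor a) • x) (PowerSeries.X * ξ) := by
    refine funext <| Fin.lastCases ?_ fun i => ?_ <;> simp
  rw [IsResponse, toMatrix_step, ← submatrix_map, Matrix.map_mul, hX, sumElim_snoc, sumElim_snoc,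
    submatrix_mulVec_equiv, Function.comp_assoc, Equiv.self_comp_symm, Function.comp_id,
    ← mulVec_mulVec, elementary_mulVec ha, fromBlocks_map, fromBlocks_mulVec, Sum.elim_comp_inl,
    Sum.elim_comp_inr, hx.mul_right]
  simp [ξ]

end Step

section Recursion

theorem blaschkeProduct_succ {n : ℕ} (α : Fin (n + 1) → ℍ) (φ : ℍ) :
    blaschkeProduct α φ =
      blaschkeProduct (Fin.init α) 1 * blaschkeFactor (α (Fin.last n)) * PowerSeries.C φ := by
  rw [blaschkeProduct, blaschkeProduct, List.ofFn_succ', List.concat_eq_append]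
  simp [Fin.init]

theorem isUnitary_recursiveBlocks {n : ℕ} {α : Fin n → ℍ} (hα : ∀ i, ‖α i‖ ≤ 1) :
    (recursiveBlocks n α).IsUnitary := by
  induction n with
  | zero =>
    have h : (recursiveBlocks 0 α).toMatrix = 1 := by
      rw [Blocks.toMatrix, ← Matrix.fromBlocks_one, Matrix.fromBlocks_inj]
      refine ⟨Subsingleton.elim _ _, Subsingleton.elim _ _, Subsingleton.elim _ _, ?_⟩
      ext1 i j
      obtain rfl := Subsingleton.elim i j
      simp [recursiveBlocks]
    rw [Blocks.IsUnitary, h]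
    exact one_mem _
  | succ n ih => exact (ih fun i => hα i.castSucc).step (hα (Fin.last n))

theorem isStable_recursiveBlocks {n : ℕ} {α : Fin n → ℍ} (hα : ∀ i, ‖α i‖ < 1) :
    IsStable (recursiveBlocks n α).A := by
  induction n with
  | zero => exact fun μ ⟨x, hx, _⟩ => (hx (Subsingleton.elim x 0)).elim
  | succ n ih => exact (ih fun i => hα i.castSucc).step (hα (Fin.last n))

theorem transfer_recursiveBlocks {n : ℕ} {α : Fin n → ℍ} (hα : ∀ i, ‖α i‖ ≤ 1) :
    (recursiveBlocks n α).transfer = blaschkeProduct α 1 := by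
  induction n with
  | zero => simp [recursiveBlocks, Blocks.transfer, blaschkeProduct, Matrix.mul_apply]
  | succ n ih =>
    rw [recursiveBlocks_succ, Blocks.transfer_step _ (hα (Fin.last n)),
      ih (α := Fin.init α) fun i => hα i.castSucc, blaschkeProduct_succ, map_one, mul_one]

theorem transfer_recursiveBlocks_mulConst {n : ℕ} {α : Fin n → ℍ} (hα : ∀ i, ‖α i‖ ≤ 1) (φ : ℍ) :
    ((recursiveBlocks n α).mulConst φ).transfer = blaschkeProduct α φ := by
  rw [Blocks.transfer_mulConst, transfer_recursiveBlocks hα, blaschkeProduct, blaschkeProduct,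
    map_one, mul_one]

end Recursion

section SplitStep

open Matrix MulOpposite

variable {n : ℕ}

theorem Blocks.toMatrix_injective : Function.Injective (toMatrix : Blocks n → _) := by
  rintro ⟨A, B, C, D⟩ ⟨A', B', C', D'⟩ h
  obtain ⟨rfl, rfl, rfl, hD⟩ := fromBlocks_inj.mp h
  obtain rfl : D = D' := congrFun₂ hD 0 0
  rfl

theorem Blocks.exists_toMatrix_eq (M : Matrix (Fin n ⊕ Fin 1) (Fin n ⊕ Fin 1) ℍ) :
    ∃ U : Blocks n, U.toMatrix = M := by
  refine ⟨⟨M.toBlocks₁₁, M.toBlocks₁₂, M.toBlocks₂₁, M (Sum.inr 0) (Sum.inr 0)⟩, ?_⟩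
  conv_rhs => rw [← fromBlocks_toBlocks M]
  refine fromBlocks_inj.mpr ⟨rfl, rfl, rfl, ?_⟩
  ext1 i j
  obtain rfl := Subsingleton.elim i 0
  obtain rfl := Subsingleton.elim j 0
  rfl

theorem Blocks.exists_step_eq {V : Blocks (n + 1)} (hV : V.IsUnitary) {a : ℍ} (ha : ‖a‖ ≤ 1)
    (hA : ∀ j : Fin n, V.A (Fin.last n) j.castSucc = 0)
    (hA_last : V.A (Fin.last n) (Fin.last n) = star a) (hB : V.B (Fin.last n) 0 = defect a) :
    ∃ U : Blocks n, U.IsUnitary ∧ U.step a = V := by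
  have hE := elementary_mem_unitary n ha
  set M := V.toMatrix.submatrix (stateEquiv n).symm (stateEquiv n).symm with hM
  have hrow : M (Sum.inr 0) = elementary n a (Sum.inr 0) := by
    ext1 ((j | j) | j)
    · simp [hM, elementary, julia, toMatrix, hA]
    · simp [hM, elementary, julia, toMatrix, hB, Subsingleton.elim j 0]
    · simp [hM, elementary, julia, toMatrix, hA_last, Subsingleton.elim j 0]
  set W := M * star (elementary n a) with hW
  have hW_row : W (Sum.inr 0) = (1 : Matrix ((Fin n ⊕ Fin 1) ⊕ Fin 1) _ ℍ) (Sum.inr 0) := by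
    ext1 j
    rw [← Unitary.mul_star_self_of_mem hE, hW, mul_apply, mul_apply, hrow]
  have hW_mem : W ∈ unitary (Matrix ((Fin n ⊕ Fin 1) ⊕ Fin 1) ((Fin n ⊕ Fin 1) ⊕ Fin 1) ℍ) :=
    mul_mem (submatrix_mem_unitary hV _) (Unitary.star_mem hE)
  obtain ⟨N, hN, hWN⟩ := exists_eq_fromBlocks_of_mem_unitary hW_mem
    (by
      ext1 i j
      obtain rfl := Subsingleton.elim i 0
      simp [toBlocks₂₁, hW_row])
    (by
      ext1 i j
      obtain rfl := Subsingleton.elim i 0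
      simp [toBlocks₂₂, hW_row, one_apply])
  obtain ⟨U, rfl⟩ := exists_toMatrix_eq N
  refine ⟨U, hN, toMatrix_injective ?_⟩
  rw [toMatrix_step, ← hWN, hW, mul_assoc, Unitary.star_mul_self_of_mem hE, mul_one, hM]
  simp

theorem Blocks.exists_conj_last_row (U : Blocks (n + 1)) :
    ∃ H ∈ unitary (Matrix (Fin (n + 1)) (Fin (n + 1)) ℍ), ∃ (a : ℍ) (s : ℝ), 0 ≤ s ∧
      (∀ j : Fin n, (U.conj H).A (Fin.last n) j.castSucc = 0) ∧
      (U.conj H).A (Fin.last n) (Fin.last n) = star a ∧ (U.conj H).B (Fin.last n) 0 = s := by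
  obtain ⟨x, a, s, hx, hAx, hs, hBx⟩ := exists_unit_right_eigenvector U.Aᴴ (U.B.col 0)
  obtain ⟨H, hH, hHx⟩ := exists_mem_unitary_mulVec_single_eq hx (Fin.last n)
  rw [mulVec_single_one] at hHx
  have hAH : (U.conj H).Aᴴ *ᵥ Pi.single (Fin.last n) 1 = op a • Pi.single (Fin.last n) 1 := by
    change (Hᴴ * U.A * H)ᴴ *ᵥ _ = _
    rw [conjTranspose_mul, conjTranspose_mul, conjTranspose_conjTranspose, ← mulVec_mulVec,
      ← mulVec_mulVec, mulVec_single_one, hHx, hAx, mulVec_smul, ← hHx, ← mulVec_single_one,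
      mulVec_mulVec, ← star_eq_conjTranspose, Unitary.star_mul_self_of_mem hH, one_mulVec]
  have hrow (j : Fin (n + 1)) : (U.conj H).A (Fin.last n) j =
      star ((op a • Pi.single (Fin.last n) 1 : Fin (n + 1) → ℍ) j) := by
    rw [← hAH]
    simp
  refine ⟨H, hH, a, s, hs, fun j => ?_, ?_, ?_⟩
  · simp [hrow]
  · simp [hrow]
  · rw [← hBx, ← hHx]
    rfl

theorem Blocks.exists_conj_eq_step {U : Blocks (n + 1)} (hU : U.IsUnitary) (hA : IsStable U.A) :
    ∃ H ∈ unitary (Matrix (Fin (n + 1)) (Fin (n + 1)) ℍ), ∃ (V : Blocks n) (a : ℍ),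
      V.IsUnitary ∧ IsStable V.A ∧ ‖a‖ < 1 ∧ V.step a = U.conj H := by
  obtain ⟨H, hH, a, s, hs, hrow, hdiag, hB⟩ := U.exists_conj_last_row
  have hUH := hU.conj hH
  have hAH := hA.conj hH
  have hrow_norm := sum_norm_sq_row_of_mem_unitary hUH (Sum.inl (Fin.last n))
  have hcol_norm := sum_norm_sq_col_of_mem_unitary hUH (Sum.inl (Fin.last n))
  have has : ‖a‖ ^ 2 + s ^ 2 = 1 := by
    simpa [toMatrix, Fin.sum_univ_castSucc, hrow, hdiag, hB] using hrow_norm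
  have ha : ‖a‖ < 1 := by
    rw [← norm_star a, ← hdiag]
    refine hAH.norm_diag_lt_one ?_
    rw [← hcol_norm, Fintype.sum_sum_type]
    exact le_add_of_nonneg_right (Finset.sum_nonneg fun _ _ => sq_nonneg _)
  obtain ⟨V, hV, hVU⟩ := exists_step_eq hUH ha.le hrow hdiag (by rw [hB, eq_defect hs has])
  refine ⟨H, hH, V, a, hV, ?_, ha, hVU⟩
  rw [← hVU] at hAH hrow
  convert hAH.submatrix_castSucc hrow using 1
  ext1 i j
  simp [step]

end SplitStep

section MulBlaschkeFactor

theorem semiconjBy_C_kernelSeries {q a b : ℍ} (h : SemiconjBy q a b) :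
    SemiconjBy (PowerSeries.C q) (kernelSeries (star a)) (kernelSeries (star b)) := by
  ext1 k
  simpa [kernelSeries] using (h.pow_right k).eq

theorem semiconjBy_C_blaschkeFactor {φ : ℍ} (hφ : ‖φ‖ = 1) (a : ℍ) :
    SemiconjBy (PowerSeries.C φ) (blaschkeFactor a) (blaschkeFactor (φ * a * star φ)) := by
  have hconj (b : ℍ) : SemiconjBy φ b (φ * b * star φ) := by
    rw [SemiconjBy, mul_assoc, Unitary.star_mul_self_of_mem (mem_unitary_of_norm_eq_one hφ),
      mul_one]
  have hX := (PowerSeries.commute_X (PowerSeries.C φ)).semiconjBy.sub_right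
    ((hconj a).map PowerSeries.C)
  have hk := semiconjBy_C_kernelSeries (hconj (star a))
  rw [star_star, star_mul, star_mul, star_star, star_star, ← mul_assoc] at hk
  exact hX.mul_right hk

theorem IsBlaschkeProduct.mul_blaschkeFactor {n : ℕ} {f : ℍ⟦X⟧} (hf : IsBlaschkeProduct n f)
    {a : ℍ} (ha : ‖a‖ < 1) : IsBlaschkeProduct (n + 1) (f * blaschkeFactor a) := by
  obtain ⟨α, φ, hα, hφ, rfl⟩ := hf
  refine ⟨Fin.snoc α (φ * a * star φ), φ, fun i => ?_, hφ, ?_⟩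
  · refine Fin.lastCases ?_ (fun i => ?_) i
    · simpa [hφ] using ha
    · simpa using hα i
  · rw [blaschkeProduct_succ, Fin.init_snoc, Fin.snoc_last, mul_assoc,
      ← (semiconjBy_C_blaschkeFactor hφ a).eq, blaschkeProduct, blaschkeProduct, map_one, mul_one,
      mul_assoc]

theorem isBlaschkeProduct_transfer {n : ℕ} {U : Blocks n} (hU : U.IsUnitary)
    (hA : IsStable U.A) : IsBlaschkeProduct n U.transfer := by
  induction n with
  | zero =>
    refine ⟨Fin.elim0, U.D, fun i => i.elim0, ?_, ?_⟩
    · have h := sum_norm_sq_col_of_mem_unitary hU (Sum.inr 0)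
      simpa [Blocks.toMatrix, pow_eq_one_iff_of_nonneg] using h
    · simp [Blocks.transfer, blaschkeProduct, Matrix.mul_apply]
  | succ n ih =>
    obtain ⟨H, hH, V, a, hV, hVA, ha, hVU⟩ := Blocks.exists_conj_eq_step hU hA
    rw [← U.transfer_conj hH, ← hVU, V.transfer_step ha.le]
    exact (ih hV hVA).mul_blaschkeFactor ha

end MulBlaschkeFactor

section PowerSeriesStar

variable {R : Type*} [Semiring R] [StarRing R]

/-- Coefficientwise conjugation of power series, for which the variable is self-adjoint. -/
noncomputable instance powerSeriesStarRing : StarRing R⟦X⟧ where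
  star f := PowerSeries.mk fun k => star (PowerSeries.coeff k f)
  star_involutive f := by
    ext1 k
    simp only [PowerSeries.coeff_mk, star_star]
  star_mul f g := by
    ext1 k
    simp only [PowerSeries.coeff_mk, PowerSeries.coeff_mul, star_sum, star_mul]
    exact Finset.Nat.sum_antidiagonal_swap (f := fun p : ℕ × ℕ =>
      star (PowerSeries.coeff p.1 g) * star (PowerSeries.coeff p.2 f))
  star_add f g := by
    ext1 k
    simp only [PowerSeries.coeff_mk, map_add, star_add]

theorem coeff_star (f : R⟦X⟧) (k : ℕ) :
    PowerSeries.coeff k (star f) = star (PowerSeries.coeff k f) :=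
  PowerSeries.coeff_mk _ _

theorem star_C (a : R) : star (PowerSeries.C a) = PowerSeries.C (star a) := by
  ext1 k
  simp only [coeff_star, PowerSeries.coeff_C, apply_ite star, star_zero]

theorem star_X : star (PowerSeries.X : R⟦X⟧) = PowerSeries.X := by
  ext1 k
  simp only [coeff_star, PowerSeries.coeff_X, apply_ite star, star_zero, star_one]

end PowerSeriesStar

section AevalX

variable {R A : Type*} [CommSemiring R] [Semiring A] [Algebra R A]

theorem coeff_aeval_X (p : Polynomial R) (k : ℕ) :
    PowerSeries.coeff k (Polynomial.aeval (PowerSeries.X : A⟦X⟧) p) =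
      algebraMap R A (p.coeff k) := by
  induction p using Polynomial.induction_on' with
  | add p q hp hq => simp only [map_add, hp, hq, Polynomial.coeff_add]
  | monomial n r =>
    simp [Polynomial.aeval_monomial, PowerSeries.algebraMap_apply, PowerSeries.coeff_X_pow,
      Polynomial.coeff_monomial, apply_ite (algebraMap R A), eq_comm]

theorem aeval_X_injective [FaithfulSMul R A] :
    Function.Injective (Polynomial.aeval (R := R) (PowerSeries.X : A⟦X⟧)) := by
  intro p q h
  ext1 k
  apply FaithfulSMul.algebraMap_injective R A
  rw [← coeff_aeval_X, ← coeff_aeval_X, h]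

theorem commute_aeval_X (f : A⟦X⟧) (p : Polynomial R) :
    Commute f (Polynomial.aeval PowerSeries.X p) := by
  induction p using Polynomial.induction_on' with
  | add p q hp hq =>
    rw [map_add]
    exact hp.add_right hq
  | monomial n r =>
    rw [Polynomial.aeval_monomial]
    exact (Algebra.commute_algebraMap_right r f).mul_right ((PowerSeries.commute_X f).pow_right n)

end AevalX

section SchurStable

/-- Schur stability of a real polynomial: all its complex roots lie in the open unit disc. -/
def IsSchurStable (p : Polynomial ℝ) : Prop :=
  ∀ z : ℂ, Polynomial.aeval z p = 0 → ‖z‖ < 1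

variable {p q : Polynomial ℝ}

theorem isSchurStable_one : IsSchurStable 1 := fun _ h => by
  simp at h

theorem IsSchurStable.mul (hp : IsSchurStable p) (hq : IsSchurStable q) :
    IsSchurStable (p * q) := fun z h => by
  rw [map_mul, mul_eq_zero] at h
  exact h.elim (hp z) (hq z)

theorem IsSchurStable.ne_zero (hp : IsSchurStable p) : p ≠ 0 := by
  rintro rfl
  simpa using hp 1 (map_zero _)

theorem IsSchurStable.isCoprime_reverse (hp : IsSchurStable p) : IsCoprime p p.reverse := by
  rw [Polynomial.isCoprime_iff_aeval_ne_zero_of_isAlgClosed ℝ ℂ]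
  intro z
  by_contra! h
  obtain ⟨hz, hz_rev⟩ := h
  have hz0 : z ≠ 0 := by
    rintro rfl
    rw [← Polynomial.coeff_zero_eq_aeval_zero', Polynomial.coeff_zero_reverse] at hz_rev
    simp [hp.ne_zero] at hz_rev
  have hz_inv : Polynomial.aeval z⁻¹ p = 0 := by
    let := invertibleOfNonzero (inv_ne_zero hz0)
    refine (Polynomial.eval₂_reverse_eq_zero_iff (algebraMap ℝ ℂ) z⁻¹ p).mp ?_
    rwa [invOf_eq_inv, inv_inv]
  have hlt := mul_lt_one_of_nonneg_of_lt_one_left (norm_nonneg _) (hp z hz) (hp _ hz_inv).le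
  rw [← norm_mul, mul_inv_cancel₀ hz0, norm_one] at hlt
  exact hlt.false

end SchurStable

section CharPoly

theorem reverse_quadratic {R : Type*} [Semiring R] [Nontrivial R] (a b : R) :
    (Polynomial.X ^ 2 + Polynomial.C a * Polynomial.X + Polynomial.C b).reverse =
      1 + Polynomial.C a * Polynomial.X + Polynomial.C b * Polynomial.X ^ 2 := by
  have hdeg :
      (Polynomial.X ^ 2 + Polynomial.C a * Polynomial.X + Polynomial.C b).natDegree = 2 := by
    compute_degree!
  have hX : (Polynomial.X : Polynomial R).reflect 2 = Polynomial.X := by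
    simpa [Polynomial.revAt_le] using Polynomial.reflect_monomial (R := R) 2 1
  rw [Polynomial.reverse, hdeg, Polynomial.reflect_add, Polynomial.reflect_add,
    Polynomial.reflect_monomial, Polynomial.reflect_C_mul, hX, Polynomial.reflect_C,
    Polynomial.revAt_le le_rfl, tsub_self, pow_zero]

/-- The characteristic polynomial `(z - α)(z - ᾱ)` of a quaternion, which has real coefficients. -/
noncomputable def charPoly (α : ℍ) : Polynomial ℝ :=
  Polynomial.X ^ 2 + Polynomial.C (-(2 * α.re)) * Polynomial.X + Polynomial.C (‖α‖ ^ 2)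

theorem natDegree_charPoly (α : ℍ) : (charPoly α).natDegree = 2 := by
  unfold charPoly
  compute_degree!

theorem coe_neg_two_mul_re (α : ℍ) : ((-(2 * α.re) : ℝ) : ℍ) = -(α + star α) := by
  rw [Quaternion.self_add_star, Quaternion.coe_neg, Quaternion.coe_mul]
  rfl

theorem aeval_X_C (r : ℝ) :
    Polynomial.aeval (PowerSeries.X : ℍ⟦X⟧) (Polynomial.C r) = PowerSeries.C (r : ℍ) := by
  rw [Polynomial.aeval_C, PowerSeries.algebraMap_apply, Quaternion.algebraMap_def]

theorem aeval_X_charPoly (α : ℍ) : Polynomial.aeval (PowerSeries.X : ℍ⟦X⟧) (charPoly α) =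
    (PowerSeries.X - PowerSeries.C α) * (PowerSeries.X - PowerSeries.C (star α)) := by
  rw [charPoly, map_add, map_add, map_mul, map_pow, Polynomial.aeval_X, aeval_X_C, aeval_X_C,
    coe_neg_two_mul_re, ← quaternion_self_mul_star]
  simp only [map_neg, map_add, map_mul, sub_mul, mul_sub, add_mul, neg_mul, PowerSeries.X_mul, sq]
  abel

theorem aeval_X_reverse_charPoly (α : ℍ) :
    Polynomial.aeval (PowerSeries.X : ℍ⟦X⟧) (charPoly α).reverse =
      (1 - PowerSeries.X * PowerSeries.C α) * (1 - PowerSeries.X * PowerSeries.C (star α)) := by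
  have hX (a b : ℍ) : (PowerSeries.X * PowerSeries.C a : ℍ⟦X⟧) * (PowerSeries.X * PowerSeries.C b) =
      PowerSeries.C (a * b) * PowerSeries.X ^ 2 := by
    rw [mul_assoc, (PowerSeries.commute_X (PowerSeries.C a)).left_comm, ← mul_assoc, ← sq,
      ← map_mul, ((PowerSeries.commute_X (PowerSeries.C (a * b))).pow_right 2).eq]
  rw [charPoly, reverse_quadratic, map_add, map_add, map_mul, map_mul, map_one, aeval_X_C,
    aeval_X_C, map_pow, Polynomial.aeval_X, coe_neg_two_mul_re, ← quaternion_self_mul_star, ← hX]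
  simp only [map_neg, map_add, sub_mul, mul_sub, add_mul, neg_mul, one_mul, mul_one,
    ← PowerSeries.X_mul]
  abel

theorem re_sq_le_norm_sq (α : ℍ) : α.re ^ 2 ≤ ‖α‖ ^ 2 := by
  rw [sq ‖α‖, ← Quaternion.normSq_eq_norm_mul_self, Quaternion.normSq_def']
  nlinarith only [sq_nonneg α.imI, sq_nonneg α.imJ, sq_nonneg α.imK]

/-- A real quadratic of nonpositive discriminant has conjugate roots, whose product is `N`. -/
theorem norm_sq_eq_of_quadratic_eq_zero {t N : ℝ} (htN : t ^ 2 ≤ N) {z : ℂ}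
    (hz : z ^ 2 - 2 * t * z + N = 0) : ‖z‖ ^ 2 = N := by
  have hre : z.re * z.re - z.im * z.im - 2 * t * z.re + N = 0 := by
    simpa [sq] using congrArg Complex.re hz
  have him : z.im * (z.re - t) = 0 := by
    have : z.re * z.im + z.im * z.re - 2 * t * z.im = 0 := by
      simpa [sq] using congrArg Complex.im hz
    linarith
  rw [Complex.sq_norm, Complex.normSq_apply]
  rcases mul_eq_zero.mp him with h_real | h_re
  · have hsq : (z.re - t) ^ 2 = 0 :=
      le_antisymm (by rw [h_real] at hre; linarith) (sq_nonneg _)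
    have ht : z.re = t := sub_eq_zero.mp (pow_eq_zero_iff two_ne_zero |>.mp hsq)
    rw [h_real, ht] at hre
    rw [h_real, ht]
    linarith
  · linear_combination 2 * z.re * h_re - hre

theorem isSchurStable_charPoly {α : ℍ} (hα : ‖α‖ < 1) : IsSchurStable (charPoly α) := by
  intro z hz
  have hz_norm : ‖z‖ ^ 2 = ‖α‖ ^ 2 := by
    refine norm_sq_eq_of_quadratic_eq_zero (re_sq_le_norm_sq α) ?_
    rw [← hz]
    simp only [charPoly, map_add, map_neg, map_mul, map_pow, Polynomial.aeval_X, Polynomial.aeval_C,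
      Complex.coe_algebraMap, Complex.ofReal_pow, Complex.ofReal_ofNat]
    ring
  rwa [(sq_eq_sq₀ (norm_nonneg _) (norm_nonneg _)).mp hz_norm]

end CharPoly

section NormPoly

/-- The norm series `f f*` is the quotient of `p` by its reciprocal polynomial. For a finite
Blaschke product and Schur stable `p`, this fraction is in lowest terms and so determines `p` up to
a scalar. -/
def HasNormPoly (f : ℍ⟦X⟧) (p : Polynomial ℝ) : Prop :=
  f * star f * Polynomial.aeval PowerSeries.X p.reverse = Polynomial.aeval PowerSeries.X p

variable {f g : ℍ⟦X⟧} {p q : Polynomial ℝ}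

theorem HasNormPoly.mul (hf : HasNormPoly f p) (hg : HasNormPoly g q) :
    HasNormPoly (f * g) (p * q) := by
  have hq := commute_aeval_X (star f) q
  have hq_rev := commute_aeval_X (star f) q.reverse
  rw [HasNormPoly] at hf hg ⊢
  rw [Polynomial.reverse_mul_of_domain, mul_comm p.reverse, map_mul, map_mul, star_mul]
  calc f * g * (star g * star f) *
        (Polynomial.aeval PowerSeries.X q.reverse * Polynomial.aeval PowerSeries.X p.reverse)
      = f * (g * star g * Polynomial.aeval PowerSeries.X q.reverse) * star f *
          Polynomial.aeval PowerSeries.X p.reverse := by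
        simp only [mul_assoc, hq_rev.left_comm]
    _ = f * star f * Polynomial.aeval PowerSeries.X p.reverse *
          Polynomial.aeval PowerSeries.X q := by
        rw [hg, mul_assoc f, ← hq.eq, ← mul_assoc f, mul_assoc, ← (commute_aeval_X _ q).eq,
          ← mul_assoc]
    _ = _ := by rw [hf]

theorem hasNormPoly_C {φ : ℍ} (hφ : ‖φ‖ = 1) : HasNormPoly (PowerSeries.C φ) 1 := by
  rw [HasNormPoly, star_C, ← map_mul, Unitary.mul_star_self_of_mem (mem_unitary_of_norm_eq_one hφ),
    map_one, one_mul, ← Polynomial.C_1, Polynomial.reverse_C]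

theorem hasNormPoly_blaschkeFactor (α : ℍ) : HasNormPoly (blaschkeFactor α) (charPoly α) := by
  have hstar : star (kernelSeries α) * (1 - PowerSeries.X * PowerSeries.C α) = 1 := by
    have := congrArg star (one_sub_mul_kernelSeries α)
    rwa [star_mul, star_sub, star_mul, star_one, star_X, star_C, star_star,
      ← PowerSeries.X_mul] at this
  have hker : kernelSeries α * star (kernelSeries α) *
      Polynomial.aeval PowerSeries.X (charPoly α).reverse = 1 := by
    rw [aeval_X_reverse_charPoly, mul_assoc, ← mul_assoc (star _), hstar, one_mul,
      kernelSeries_mul_one_sub]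
  rw [HasNormPoly, aeval_X_charPoly, blaschkeFactor, star_mul, star_sub, star_X, star_C]
  calc (PowerSeries.X - PowerSeries.C α) * kernelSeries α *
        (star (kernelSeries α) * (PowerSeries.X - PowerSeries.C (star α))) *
          Polynomial.aeval PowerSeries.X (charPoly α).reverse
      = (PowerSeries.X - PowerSeries.C α) * (kernelSeries α * star (kernelSeries α) *
          ((PowerSeries.X - PowerSeries.C (star α)) *
            Polynomial.aeval PowerSeries.X (charPoly α).reverse)) := by simp only [mul_assoc]
    _ = (PowerSeries.X - PowerSeries.C α) * (PowerSeries.X - PowerSeries.C (star α)) := by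
        rw [(commute_aeval_X _ _).eq, ← mul_assoc (_ * _), hker, one_mul]

theorem IsBlaschkeProduct.exists_hasNormPoly {n : ℕ} (hf : IsBlaschkeProduct n f) :
    ∃ p, HasNormPoly f p ∧ IsSchurStable p ∧ p.natDegree = 2 * n := by
  obtain ⟨α, φ, hα, hφ, rfl⟩ := hf
  induction n generalizing φ with
  | zero => exact ⟨1, by simpa [blaschkeProduct] using hasNormPoly_C hφ, isSchurStable_one, by simp⟩
  | succ n ih =>
    obtain ⟨p, hp_norm, hp, hp_deg⟩ := ih (Fin.init α) 1 (fun i => hα i.castSucc) norm_one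
    have hc := isSchurStable_charPoly (hα (Fin.last n))
    refine ⟨p * charPoly (α (Fin.last n)), ?_, hp.mul hc, ?_⟩
    · rw [blaschkeProduct_succ, ← mul_one (p * _)]
      exact (hp_norm.mul (hasNormPoly_blaschkeFactor _)).mul (hasNormPoly_C hφ)
    · rw [Polynomial.natDegree_mul hp.ne_zero hc.ne_zero, hp_deg, natDegree_charPoly]
      ring

theorem HasNormPoly.mul_reverse_comm (hp : HasNormPoly f p) (hq : HasNormPoly f q) :
    p * q.reverse = q * p.reverse := by
  apply aeval_X_injective (A := ℍ)
  rw [map_mul, map_mul, ← hp, ← hq, mul_assoc, mul_assoc (f * star f), ← map_mul, ← map_mul,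
    mul_comm p.reverse]

theorem HasNormPoly.dvd (hp_norm : HasNormPoly f p) (hq_norm : HasNormPoly f q)
    (hp : IsSchurStable p) : p ∣ q :=
  hp.isCoprime_reverse.dvd_of_dvd_mul_right (hp_norm.mul_reverse_comm hq_norm ▸ dvd_mul_right _ _)

theorem IsBlaschkeProduct.degree_unique {n m : ℕ} (hn : IsBlaschkeProduct n f)
    (hm : IsBlaschkeProduct m f) : m = n := by
  obtain ⟨p, hp_norm, hp, hp_deg⟩ := hn.exists_hasNormPoly
  obtain ⟨q, hq_norm, hq, hq_deg⟩ := hm.exists_hasNormPoly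
  have hpq := Polynomial.natDegree_le_of_dvd (hp_norm.dvd hq_norm hp) hq.ne_zero
  have hqp := Polynomial.natDegree_le_of_dvd (hq_norm.dvd hp_norm hq) hp.ne_zero
  omega

end NormPoly

end QBlaschke

theorem theorem3 :
    -- a stable unitary matrix of size `n + 1` gives a Blaschke product of degree exactly `n`
    (∀ (n : ℕ) (U : QBlaschke.Blocks n), U.IsUnitary → QBlaschke.IsStable U.A →
      QBlaschke.IsBlaschkeProduct n U.transfer ∧
        ∀ m : ℕ, QBlaschke.IsBlaschkeProduct m U.transfer → m = n) ∧
    -- every finite Blaschke product of degree `n` has a stable unitary realization of size `n + 1`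
    (∀ (n : ℕ) (f : ℍ⟦X⟧), QBlaschke.IsBlaschkeProduct n f →
      ∃ U : QBlaschke.Blocks n, U.IsUnitary ∧ QBlaschke.IsStable U.A ∧ f = U.transfer) ∧
    -- for every factorization such a realization is given by the recursive construction
    (∀ (n : ℕ) (α : Fin n → ℍ) (φ : ℍ), (∀ i, ‖α i‖ < 1) → ‖φ‖ = 1 →
      ((QBlaschke.recursiveBlocks n α).mulConst φ).IsUnitary ∧
        QBlaschke.IsStable ((QBlaschke.recursiveBlocks n α).mulConst φ).A ∧
        QBlaschke.blaschkeProduct α φ =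
          ((QBlaschke.recursiveBlocks n α).mulConst φ).transfer) := by
  have hreal (n : ℕ) (α : Fin n → ℍ) (φ : ℍ) (hα : ∀ i, ‖α i‖ < 1) (hφ : ‖φ‖ = 1) :
      ((QBlaschke.recursiveBlocks n α).mulConst φ).IsUnitary ∧
        QBlaschke.IsStable ((QBlaschke.recursiveBlocks n α).mulConst φ).A ∧
        QBlaschke.blaschkeProduct α φ =
          ((QBlaschke.recursiveBlocks n α).mulConst φ).transfer :=
    ⟨(QBlaschke.isUnitary_recursiveBlocks fun i => (hα i).le).mulConst hφ,
      QBlaschke.isStable_recursiveBlocks hα,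
      (QBlaschke.transfer_recursiveBlocks_mulConst (fun i => (hα i).le) φ).symm⟩
  refine ⟨fun n U hU hA => ?_, ?_, hreal⟩
  · have hf := QBlaschke.isBlaschkeProduct_transfer hU hA
    exact ⟨hf, fun m hm => hf.degree_unique hm⟩
  · rintro n _ ⟨α, φ, hα, hφ, rfl⟩
    exact ⟨_, hreal n α φ hα hφ⟩
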